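/- Let $\mathbf{C}^7$ have coordinates $(s_3,\tau)$ with $\tau=(t_1,t_2,t_3,t_4,t_5,t_7)$, and put $$\tilde f=\tilde f_{(s_3,\tau)}(x,y,z)=y^3+x^3y+t_7x+t_5x^2+t_3x^3+t_1x^4+y(t_4x+t_2x^2)+s_3y^2-z^2,\qquad f_\tau=\tilde f_{(0,\tau)}.$$ Let ${\cal F}$ be the family of the surfaces $\{f_\tau(x,y,z)=0\}\subset\mathbf{C}^3$, $\tau\in\mathbf{C}^6$, and let $$C_f=\{\tau\in\mathbf{C}^6 \mid \exists (x,y,z)\in\mathbf{C}^3:\ f_\tau=\partial_xf_\tau=\partial_yf_\tau=\partial_zf_\tau=0\ \text{at}\ (x,y,z)\}$$ be its critical locus. Put $(m_1,\dots,m_7)=(1,x,x^2,x^3,x^4,y,xy)$ and $(n_1,\dots,n_7)=(x,x^2,x^3,x^4,y,xy,x^2y)$. There is a unique $7\times7$ matrix $A=(A_{ij})$ with entries in $\mathbf{C}[s_3,t_1,\dots,t_5,t_7]$ such that, for all $i$, $$m_i\tilde f\equiv\sum_{j=1}^7A_{ij}n_j \mod (\partial_x\tilde f,\partial_y\tilde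 f,\partial_z\tilde f)$$ in $\mathbf{C}[s_3,t_1,\dots,t_5,t_7][x,y,z]$. There are unique polynomials $\tilde\delta(s_3,\tau)$ and $\delta_{\rm ST34}(\tau)$ over $\mathbf{C}$ with $$\det A=\left(\tfrac79\right)^7t_7\,\tilde\delta(s_3,\tau),\qquad \tilde\delta(0,\tau)=t_7\,\delta_{\rm ST34}(\tau).$$ Then the polynomial $\delta_{\rm ST34}$ so defined has the following properties. (i) There are polynomials $A_1,\dots,A_6\in\mathbf{C}[t_1,t_2,t_3,t_4,t_5]$ such that $$\delta_{\rm ST34}(\tau)=t_7^6+\sum_{j=1}^6A_j(t_1,t_2,t_3,t_4,t_5)\,t_7^{6-j}.$$ (ii) $C_f=\{\tau\in\mathbf{C}^6\mid t_7\cdot\delta_{\rm ST34}(\tau)=0\}$. -/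

import Mathlib

namespace ST34

noncomputable section

open Polynomial in
theorem remainder_unique {R : Type*} [CommRing R] [IsDomain R] (a b c d : Polynomial R) (u v : Polynomial (Polynomial R))
    (s₀ s₁ : Polynomial R)
    (ha : a.natDegree = 2) (hb : b.natDegree ≤ 3) (hb0 : b.coeff 0 ≠ 0)
    (hres : 7 ≤ (a ^ 2 * c + b ^ 2 - d * a * b).natDegree)
    (h0 : s₀.natDegree ≤ 4) (h00 : s₀.coeff 0 = 0) (h1 : s₁.natDegree ≤ 2)
    (e : u * (C a * X + C b) + v * (X ^ 2 + C d * X + C c) = C s₀ + C s₁ * X) :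
    s₀ = 0 ∧ s₁ = 0 := by
  set G : Polynomial (Polynomial R) := X ^ 2 + C d * X + C c with hG
  have hGd : G.natDegree = 2 := by rw [hG]; compute_degree!
  have hGm : G.Monic := by rw [hG]; monicity!
  set r := u %ₘ G with hr
  have hrd : r.natDegree ≤ 1 := by
    have := natDegree_modByMonic_lt u hGm (by intro h; rw [h] at hGd; simp at hGd)
    rw [← hr] at this
    omega
  have hr1 : r = C (r.coeff 1) * X + C (r.coeff 0) := eq_X_add_C_of_natDegree_le_one hrd
  have hu : u = r + G * (u /ₘ G) := (modByMonic_add_div u G).symm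
  set u₀ := r.coeff 0
  set u₁ := r.coeff 1
  have key : G * ((u /ₘ G) * (C a * X + C b) + v + C (a * u₁))
      = C (s₀ - (u₀ * b - u₁ * a * c)) + C (s₁ - (u₀ * a + u₁ * b - d * u₁ * a)) * X := by
    rw [hu, hr1] at e
    have e' : G * ((u /ₘ G) * (C a * X + C b) + v + C (a * u₁))
      = C s₀ + C s₁ * X - (C u₁ * X + C u₀) * (C a * X + C b) + G * C (a * u₁) := by
      rw [← e]; ring
    rw [e', hG]
    simp only [C_sub, C_add, C_mul]
    ring
  have hw : (u /ₘ G) * (C a * X + C b) + v + C (a * u₁) = 0 := by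
    by_contra hne
    have := hGm.natDegree_mul' hne
    rw [key] at this
    have h2 : (C (s₀ - (u₀ * b - u₁ * a * c)) + C (s₁ - (u₀ * a + u₁ * b - d * u₁ * a)) * X).natDegree ≤ 1 := by
      compute_degree
    omega
  rw [hw, mul_zero] at key
  have k0 : s₀ = u₀ * b - u₁ * a * c := by
    have := congrArg (fun q => q.coeff 0) key
    simp at this
    linear_combination -this
  have k1 : s₁ = u₀ * a + u₁ * b - d * u₁ * a := by
    have := congrArg (fun q => q.coeff 1) key
    simp [coeff_C] at this
    linear_combination -this
  have hu1 : u₁ = 0 := by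
    by_contra hne
    have hk : s₁ * b - s₀ * a = u₁ * (a ^ 2 * c + b ^ 2 - d * a * b) := by
      rw [k0, k1]; ring
    have hne2 : a ^ 2 * c + b ^ 2 - d * a * b ≠ 0 := by
      intro h; rw [h] at hres; simp at hres
    have hd := natDegree_mul hne hne2
    rw [← hk] at hd
    have hle : (s₁ * b - s₀ * a).natDegree ≤ 6 := by
      refine (natDegree_sub_le _ _).trans (max_le ?_ ?_)
      · exact natDegree_mul_le.trans (by omega)
      · exact natDegree_mul_le.trans (by omega)
    omega
  rw [hu1] at k0 k1
  have k0' : s₀ = u₀ * b := by rw [k0]; ring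
  have k1' : s₁ = u₀ * a := by rw [k1]; ring
  have hu0 : u₀ = 0 := by
    by_contra hne
    have hane : a ≠ 0 := by intro h; rw [h] at ha; simp at ha
    have hd := natDegree_mul hne hane
    rw [← k1'] at hd
    have hz : u₀.natDegree = 0 := by omega
    rw [eq_C_of_natDegree_eq_zero hz] at k0'
    rw [k0', coeff_C_mul] at h00
    rcases mul_eq_zero.1 h00 with h | h
    · apply hne; rw [eq_C_of_natDegree_eq_zero hz, h, C_0]
    · exact hb0 h
  exact ⟨by rw [k0', hu0, zero_mul], by rw [k1', hu0, zero_mul]⟩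

open MvPolynomial

/-- The polynomial
`y³ + x³y + t₇x + t₅x² + t₃x³ + t₁x⁴ + y(t₄x + t₂x²) + s₃y² - z²`
in the three variables `x = X 0`, `y = X 1`, `z = X 2`, with parameters
`p = (s₃, t₁, t₂, t₃, t₄, t₅, t₇)` taken from a commutative ring `R`. -/
def surfacePoly {R : Type*} [CommRing R] (p : Fin 7 → R) : MvPolynomial (Fin 3) R :=
  X 1 ^ 3 + X 0 ^ 3 * X 1 + C (p 6) * X 0 + C (p 5) * X 0 ^ 2 + C (p 3) * X 0 ^ 3
    + C (p 1) * X 0 ^ 4 + X 1 * (C (p 4) * X 0 + C (p 2) * X 0 ^ 2)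
    + C (p 0) * X 1 ^ 2 - X 2 ^ 2

/-- The monomials `1, x, x², x³, x⁴, y, xy`. -/
def rowMonomial (R : Type*) [CommRing R] : Fin 7 → MvPolynomial (Fin 3) R :=
  ![1, X 0, X 0 ^ 2, X 0 ^ 3, X 0 ^ 4, X 1, X 0 * X 1]

/-- The monomials `x, x², x³, x⁴, y, xy, x²y`. -/
def colMonomial (R : Type*) [CommRing R] : Fin 7 → MvPolynomial (Fin 3) R :=
  ![X 0, X 0 ^ 2, X 0 ^ 3, X 0 ^ 4, X 1, X 0 * X 1, X 0 ^ 2 * X 1]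

/-- The Jacobian ideal: generated by the three partial derivatives. -/
def jacobianIdeal {R : Type*} [CommRing R] (p : Fin 7 → R) : Ideal (MvPolynomial (Fin 3) R) :=
  Ideal.span (Set.range fun k => pderiv k (surfacePoly p))

variable {R : Type*} [CommRing R]

/-- `A` is a matrix of coefficients for the family: for each of the seven monomials
`m₁, …, m₇ = 1, x, x², x³, x⁴, y, xy`, the product `mᵢ f` is congruent, modulo the ideal
`(∂f/∂x, ∂f/∂y, ∂f/∂z)`, to `∑ⱼ Aᵢⱼ nⱼ` with `n₁, …, n₇ = x, x², x³, x⁴, y, xy, x²y`. Since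
`∂f/∂z = -2z`, this is the same as `(∑ᵢ aᵢ mᵢ)(f + z²) + g₂ ∂f/∂x + g₃ ∂f/∂y = ∑ᵢⱼ aᵢ Aᵢⱼ nⱼ`
for suitable polynomials `g₂, g₃`, for all constants `a₁, …, a₇`. -/
def IsCoefficientMatrix (p : Fin 7 → R) (A : Matrix (Fin 7) (Fin 7) R) : Prop :=
  ∀ i, rowMonomial R i * surfacePoly p - ∑ j, C (A i j) * colMonomial R j ∈ jacobianIdeal p

/-! The next definitions and facts serve only to show that such a matrix exists, is unique when the
parameters are independent variables, and has a determinant with the divisibility needed below. -/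

/-- coordinates of the defining polynomial itself; `h` is to be `1 / 3` -/
def auxV (p : Fin 7 → R) (h : R) : Fin 7 → R :=
  ![-(h ^ 2 * p 0 * p 4) + 7 * h ^ 2 * p 6, -(h ^ 2 * p 0 * p 2) + 5 * h ^ 2 * p 5,
    -(h ^ 2 * p 0) + h * p 3, h ^ 2 * p 1, -(2 * h ^ 2 * p 0 ^ 2), 4 * h ^ 2 * p 4,
    2 * h ^ 2 * p 2]

/-- multiplication by `x` on the monomials `nⱼ` -/
def auxX (p : Fin 7 → R) (h : R) : Matrix (Fin 7) (Fin 7) R :=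
  !![0, 1, 0, 0, 0, 0, 0;
    0, 0, 1, 0, 0, 0, 0;
    0, 0, 0, 1, 0, 0, 0;
    -(4 * h * p 1 * p 6) - h * p 4 ^ 2, -(8 * h * p 1 * p 5) - p 2 * p 4, -(4 * p 1 * p 3) - 2 * h * p 2 ^ 2 - 4 * h * p 4, -(16 * h * p 1 ^ 2) - 5 * h * p 2, -(2 * h * p 0 * p 4) + p 6, -(4 * h * p 0 * p 2) - 4 * h * p 1 * p 4 + 2 * p 5, -(2 * p 0) - 8 * h * p 1 * p 2 + 3 * p 3;
    0, 0, 0, 0, 0, 1, 0;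
    0, 0, 0, 0, 0, 0, 1;
    -(h * p 6), -(2 * h * p 5), -(p 3), -(4 * h * p 1), 0, -(h * p 4), -(2 * h * p 2)]

/-- multiplication by `y` on the monomials `nⱼ` -/
def auxY (p : Fin 7 → R) (h : R) : Matrix (Fin 7) (Fin 7) R :=
  !![0, 0, 0, 0, 0, 1, 0;
    0, 0, 0, 0, 0, 0, 1;
    -(h * p 6), -(2 * h * p 5), -(p 3), -(4 * h * p 1), 0, -(h * p 4), -(2 * h * p 2);
    16 * h ^ 2 * p 1 ^ 2 * p 6 + 4 * h ^ 2 * p 1 * p 4 ^ 2 + 2 * h ^ 2 * p 2 * p 6, 32 * h ^ 2 * p 1 ^ 2 * p 5 + 4 * h * p 1 * p 2 * p 4 + 4 * h ^ 2 * p 2 * p 5 - h * p 6, 16 * h * p 1 ^ 2 * p 3 + 8 * h ^ 2 * p 1 * p 2 ^ 2 + 16 * h ^ 2 * p 1 * p 4 + 2 * h * p 2 * p 3 - 2 * h * p 5, 64 * h ^ 2 * p 1 ^ 3 + 28 * h ^ 2 * p 1 * p 2 - p 3, 8 * h ^ 2 * p 0 * p 1 * p 4 - 4 * h * p 1 * p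 6, 16 * h ^ 2 * p 0 * p 1 * p 2 + 16 * h ^ 2 * p 1 ^ 2 * p 4 - 8 * h * p 1 * p 5 + 2 * h ^ 2 * p 2 * p 4, 8 * h * p 0 * p 1 + 32 * h ^ 2 * p 1 ^ 2 * p 2 - 4 * p 1 * p 3 + 4 * h ^ 2 * p 2 ^ 2 - h * p 4;
    -(h * p 4), -(h * p 2), -h, 0, -(2 * h * p 0), 0, 0;
    0, -(h * p 4), -(h * p 2), -h, 0, -(2 * h * p 0), 0;
    4 * h ^ 2 * p 1 * p 6 + h ^ 2 * p 4 ^ 2, 8 * h ^ 2 * p 1 * p 5 + h * p 2 * p 4, 4 * h * p 1 * p 3 + 2 * h ^ 2 * p 2 ^ 2 + h ^ 2 * p 4, 16 * h ^ 2 * p 1 ^ 2 + 2 * h ^ 2 * p 2, 2 * h ^ 2 * p 0 * p 4 - h * p 6, 4 * h ^ 2 * p 0 * p 2 + 4 * h ^ 2 * p 1 * p 4 - 2 * h * p 5, 8 * h ^ 2 * p 1 * p 2 - p 3]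

open Matrix in
/-- an explicit coefficient matrix -/
def auxA (p : Fin 7 → R) (h : R) : Matrix (Fin 7) (Fin 7) R :=
  Matrix.of ![auxV p h, auxV p h ᵥ* auxX p h, auxV p h ᵥ* auxX p h ᵥ* auxX p h,
    auxV p h ᵥ* auxX p h ᵥ* auxX p h ᵥ* auxX p h,
    auxV p h ᵥ* auxX p h ᵥ* auxX p h ᵥ* auxX p h ᵥ* auxX p h,
    auxV p h ᵥ* auxY p h, auxV p h ᵥ* auxY p h ᵥ* auxX p h]

/-- a combination of the column monomials -/
def comb (w : Fin 7 → R) : MvPolynomial (Fin 3) R := ∑ j, C (w j) * colMonomial R j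

/-- the partial derivative in `x` -/
def derX (p : Fin 7 → R) : MvPolynomial (Fin 3) R :=
  3 * X 0 ^ 2 * X 1 + C (p 6) + 2 * C (p 5) * X 0 + 3 * C (p 3) * X 0 ^ 2
    + 4 * C (p 1) * X 0 ^ 3 + X 1 * (C (p 4) + 2 * C (p 2) * X 0)

/-- the partial derivative in `y` -/
def derY (p : Fin 7 → R) : MvPolynomial (Fin 3) R :=
  3 * X 1 ^ 2 + X 0 ^ 3 + C (p 4) * X 0 + C (p 2) * X 0 ^ 2 + 2 * C (p 0) * X 1

theorem pderiv_zero_surfacePoly (p : Fin 7 → R) : pderiv 0 (surfacePoly p) = derX p := by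
  simp [surfacePoly, derX, pderiv_X]; ring

theorem pderiv_one_surfacePoly (p : Fin 7 → R) : pderiv 1 (surfacePoly p) = derY p := by
  simp [surfacePoly, derY, pderiv_X]; ring

theorem pderiv_two_surfacePoly (p : Fin 7 → R) : pderiv 2 (surfacePoly p) = -2 * X 2 := by
  simp [surfacePoly, pderiv_X]

theorem mem_of_eq (p : Fin 7 → R) {q : MvPolynomial (Fin 3) R} (u v w : MvPolynomial (Fin 3) R)
    (e : q = u * derX p + v * derY p + w * (-2 * X 2)) : q ∈ jacobianIdeal p := by
  rw [e, ← pderiv_zero_surfacePoly, ← pderiv_one_surfacePoly, ← pderiv_two_surfacePoly]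
  refine add_mem (add_mem ?_ ?_) ?_ <;>
  exact Ideal.mul_mem_left _ _ (Ideal.subset_span ⟨_, rfl⟩)

theorem auxX_mem (p : Fin 7 → R) (h : R) (hh : 3 * h = 1) (i : Fin 7) :
    X 0 * colMonomial R i - comb (auxX p h i) ∈ jacobianIdeal p := by
  have hC : 3 * C h = (1 : MvPolynomial (Fin 3) R) := by
    rw [← C_1, ← hh, C_mul, map_ofNat]
  fin_cases i
  · exact mem_of_eq p 0 0 0 (by simp [comb, colMonomial, auxX, Fin.sum_univ_succ]; ring)
  · exact mem_of_eq p 0 0 0 (by simp [comb, colMonomial, auxX, Fin.sum_univ_succ]; ring)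
  · exact mem_of_eq p 0 0 0 (by simp [comb, colMonomial, auxX, Fin.sum_univ_succ]; ring)
  · refine mem_of_eq p (4 * C h * C (p 1) * X 0 - X 1)
      (2 * C h * C (p 2) * X 0 + C h * C (p 4) + X 0 ^ 2) 0 ?_
    simp [comb, colMonomial, auxX, Fin.sum_univ_succ, derX, derY, map_ofNat]
    grind
  · exact mem_of_eq p 0 0 0 (by simp [comb, colMonomial, auxX, Fin.sum_univ_succ])
  · exact mem_of_eq p 0 0 0 (by simp [comb, colMonomial, auxX, Fin.sum_univ_succ]; ring)
  · refine mem_of_eq p (C h * X 0) 0 0 ?_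
    simp [comb, colMonomial, auxX, Fin.sum_univ_succ, derX, map_ofNat]
    grind

theorem auxY_mem (p : Fin 7 → R) (h : R) (hh : 3 * h = 1) (i : Fin 7) :
    X 1 * colMonomial R i - comb (auxY p h i) ∈ jacobianIdeal p := by
  have hC : 3 * C h = (1 : MvPolynomial (Fin 3) R) := by
    rw [← C_1, ← hh, C_mul, map_ofNat]
  fin_cases i
  · exact mem_of_eq p 0 0 0 (by simp [comb, colMonomial, auxY, Fin.sum_univ_succ]; ring)
  · exact mem_of_eq p 0 0 0 (by simp [comb, colMonomial, auxY, Fin.sum_univ_succ]; ring)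
  · refine mem_of_eq p (C h * X 0) 0 0 ?_
    simp [comb, colMonomial, auxY, Fin.sum_univ_succ, derX, map_ofNat]
    grind
  · refine mem_of_eq p (-(16 * C h ^ 2 * C (p 1) ^ 2 * X 0) + 4 * C h * C (p 1) * X 1
        - 2 * C h ^ 2 * C (p 2) * X 0 + C h * X 0 ^ 2)
      (-(8 * C h ^ 2 * C (p 1) * C (p 2) * X 0) - 4 * C h ^ 2 * C (p 1) * C (p 4)
        - 4 * C h * C (p 1) * X 0 ^ 2) 0 ?_
    simp [comb, colMonomial, auxY, Fin.sum_univ_succ, derX, derY, map_ofNat]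
    grind
  · refine mem_of_eq p 0 (C h) 0 ?_
    simp [comb, colMonomial, auxY, Fin.sum_univ_succ, derY, map_ofNat]
    grind
  · refine mem_of_eq p 0 (C h * X 0) 0 ?_
    simp [comb, colMonomial, auxY, Fin.sum_univ_succ, derY, map_ofNat]
    grind
  · refine mem_of_eq p (-(4 * C h ^ 2 * C (p 1) * X 0) + C h * X 1)
      (-(2 * C h ^ 2 * C (p 2) * X 0) - C h ^ 2 * C (p 4)) 0 ?_
    simp [comb, colMonomial, auxY, Fin.sum_univ_succ, derX, derY, map_ofNat]
    grind


theorem auxV_mem (p : Fin 7 → R) (h k : R) (hh : 3 * h = 1) (hk : 2 * k = 1) :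
    surfacePoly p - comb (auxV p h) ∈ jacobianIdeal p := by
  have hC : 3 * C h = (1 : MvPolynomial (Fin 3) R) := by
    rw [← C_1, ← hh, C_mul, map_ofNat]
  have kC : 2 * C k = (1 : MvPolynomial (Fin 3) R) := by
    rw [← C_1, ← hk, C_mul, map_ofNat]
  refine mem_of_eq p (2 * C h ^ 2 * X 0) (C h ^ 2 * C (p 0) + C h * X 1) (C k * X 2) ?_
  simp [comb, colMonomial, auxV, Fin.sum_univ_succ, derX, derY, map_ofNat, surfacePoly]
  grind

open Matrix in
theorem comb_vecMul (v : Fin 7 → R) (M : Matrix (Fin 7) (Fin 7) R) :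
    comb (v ᵥ* M) = ∑ i, C (v i) * comb (M i) := by
  simp only [comb, Matrix.vecMul, dotProduct, map_sum, C_mul, Finset.mul_sum, Finset.sum_mul]
  rw [Finset.sum_comm]
  simp only [mul_assoc]

open Matrix in
theorem step_mem (p : Fin 7 → R) (M : Matrix (Fin 7) (Fin 7) R) (a q : MvPolynomial (Fin 3) R)
    (v : Fin 7 → R) (hM : ∀ i, a * colMonomial R i - comb (M i) ∈ jacobianIdeal p)
    (hq : q - comb v ∈ jacobianIdeal p) : a * q - comb (v ᵥ* M) ∈ jacobianIdeal p := by
  have e : a * q - comb (v ᵥ* M) = a * (q - comb v)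
      + ∑ i, C (v i) * (a * colMonomial R i - comb (M i)) := by
    rw [comb_vecMul]
    simp only [mul_sub, Finset.sum_sub_distrib]
    have : a * comb v = ∑ i, C (v i) * (a * colMonomial R i) := by
      rw [comb, Finset.mul_sum]
      exact Finset.sum_congr rfl fun i _ => by ring
    rw [this]; ring
  rw [e]
  exact add_mem (Ideal.mul_mem_left _ _ hq)
    (Ideal.sum_mem _ fun i _ => Ideal.mul_mem_left _ _ (hM i))

theorem auxA_isCoefficientMatrix (p : Fin 7 → R) (h k : R) (hh : 3 * h = 1) (hk : 2 * k = 1) :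
    IsCoefficientMatrix p (auxA p h) := by
  have hX := auxX_mem p h hh
  have h0 := auxV_mem p h k hh hk
  have h1 := step_mem p _ _ _ _ hX h0
  have h2 := step_mem p _ _ _ _ hX h1
  have h3 := step_mem p _ _ _ _ hX h2
  have h4 := step_mem p _ _ _ _ hX h3
  have h5 := step_mem p _ _ _ _ (auxY_mem p h hh) h0
  have h6 := step_mem p _ _ _ _ hX h5
  have key : ∀ {m q : MvPolynomial (Fin 3) R} {v : Fin 7 → R}, q = m * surfacePoly p →
      q - comb v ∈ jacobianIdeal p → m * surfacePoly p - comb v ∈ jacobianIdeal p := by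
    rintro _ _ _ rfl hm
    exact hm
  intro i
  fin_cases i
  · exact key (by simp [rowMonomial]) h0
  · exact key (by simp [rowMonomial]) h1
  · exact key (by simp [rowMonomial]; ring) h2
  · exact key (by simp [rowMonomial]; ring) h3
  · exact key (by simp [rowMonomial]; ring) h4
  · exact key (by simp [rowMonomial]) h5
  · exact key (by simp [rowMonomial]; ring) h6

open Matrix in
theorem auxA_dvd (p : Fin 7 → R) (h q : R) (w x₁ : Fin 7 → R) (hv : q ∣ auxV p h ⬝ᵥ w)
    (hx : auxX p h *ᵥ w = q • x₁) (hy : q ∣ auxV p h ⬝ᵥ (auxY p h *ᵥ w)) (i : Fin 7) :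
    q ∣ (auxA p h *ᵥ w) i := by
  have hs : ∀ v : Fin 7 → R, q ∣ (v ᵥ* auxX p h) ⬝ᵥ w := fun v => by
    rw [← dotProduct_mulVec, hx, dotProduct_smul, smul_eq_mul]
    exact dvd_mul_right _ _
  fin_cases i
  · exact hv
  · exact hs _
  · exact hs _
  · exact hs _
  · exact hs _
  · rw [dotProduct_mulVec] at hy
    exact hy
  · exact hs _

open Matrix in
theorem auxA_mulVec_one (p : Fin 7 → R) (h : R) (_hh : 3 * h = 1) (i : Fin 7) :
    p 6 ∣ (auxA p h *ᵥ ![2 * p 0, 0, 0, 0, -p 4, 0, 0]) i := by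
  set w : Fin 7 → R := ![2 * p 0, 0, 0, 0, -p 4, 0, 0] with hw
  have hv : auxV p h ⬝ᵥ w = p 6 * (14 * h ^ 2 * p 0) := by
    simp [hw, auxV, dotProduct, Fin.sum_univ_succ]; ring
  have hx : auxX p h *ᵥ w = p 6 • ![0, 0, 0, -(8 * h * p 0 * p 1) - p 4, 0, 0, -(2 * h * p 0)] := by
    ext j
    fin_cases j <;> simp [hw, auxX, mulVec, dotProduct, Fin.sum_univ_succ] <;> grind
  have hy : auxY p h *ᵥ w = p 6 • ![0, 0, -(2 * h * p 0),
      32 * h ^ 2 * p 0 * p 1 ^ 2 + 4 * h ^ 2 * p 0 * p 2 + 4 * h * p 1 * p 4, 0, 0,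
      8 * h ^ 2 * p 0 * p 1 + h * p 4] := by
    ext j
    fin_cases j <;> simp [hw, auxY, mulVec, dotProduct, Fin.sum_univ_succ] <;> grind
  exact auxA_dvd p h _ w _ (hv ▸ dvd_mul_right _ _) hx
    (by rw [hy, dotProduct_smul, smul_eq_mul]; exact dvd_mul_right _ _) i

open Matrix in
theorem auxA_mulVec_two (p : Fin 7 → R) (h : R) (_hh : 3 * h = 1) (h0 : p 0 = 0) (i : Fin 7) :
    p 6 ^ 2 ∣ (auxA p h *ᵥ ![p 6, 0, 0, 0, h * p 4 ^ 2, 0, 0]) i := by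
  set w : Fin 7 → R := ![p 6, 0, 0, 0, h * p 4 ^ 2, 0, 0] with hw
  have hv : auxV p h ⬝ᵥ w = p 6 ^ 2 * (7 * h ^ 2) := by
    simp [hw, auxV, dotProduct, Fin.sum_univ_succ, h0]; ring
  have hx : auxX p h *ᵥ w = p 6 ^ 2 • ![0, 0, 0, -(4 * h * p 1), 0, 0, -h] := by
    ext j
    fin_cases j <;> simp [hw, auxX, mulVec, dotProduct, Fin.sum_univ_succ, h0] <;> grind
  have hy : auxV p h ⬝ᵥ (auxY p h *ᵥ w) = p 6 ^ 2 * (auxV p h ⬝ᵥ ![0, 0, -h,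
      16 * h ^ 2 * p 1 ^ 2 + 2 * h ^ 2 * p 2, 0, 0, 4 * h ^ 2 * p 1]) := by
    simp [hw, auxV, auxY, mulVec, dotProduct, Fin.sum_univ_succ, h0]
    grind
  exact auxA_dvd p h _ w _ (hv ▸ dvd_mul_right _ _) hx (hy ▸ dvd_mul_right _ _) i


theorem comb_eq_zero [IsDomain R] (p : Fin 7 → R) (h : R) (hh : 3 * h = 1) (h6 : p 6 ≠ 0)
    (d : Fin 7 → R) (hd : comb d ∈ jacobianIdeal p) : d = 0 := by
  have h3 : (3 : R) ≠ 0 := by intro h3; simp [h3] at hh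
  have hh0 : h ≠ 0 := by rintro rfl; simp at hh
  let ψ : MvPolynomial (Fin 3) R →+* Polynomial (Polynomial R) :=
    eval₂Hom (Polynomial.C.comp Polynomial.C) ![Polynomial.C Polynomial.X, Polynomial.X, 0]
  obtain ⟨c, hc⟩ := (Ideal.mem_span_range_iff_exists_fun).1 hd
  rw [Fin.sum_univ_three, pderiv_zero_surfacePoly, pderiv_one_surfacePoly,
    pderiv_two_surfacePoly] at hc
  let P : R → Polynomial R := fun r => Polynomial.C r
  let x : Polynomial R := Polynomial.X
  have hP : 3 * P h = 1 := by
    change 3 * Polynomial.C h = 1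
    rw [← Polynomial.C_1, ← hh, Polynomial.C_mul, map_ofNat]
  have e := congrArg ψ hc
  have e2 : ψ (c 0) * (Polynomial.C (Polynomial.C 3 * x ^ 2 + Polynomial.C (2 * p 2) * x + P (p 4)) * Polynomial.X
        + Polynomial.C (Polynomial.C (4 * p 1) * x ^ 3 + Polynomial.C (3 * p 3) * x ^ 2
          + Polynomial.C (2 * p 5) * x + P (p 6)))
      + (3 * ψ (c 1)) * (Polynomial.X ^ 2 + Polynomial.C (Polynomial.C (2 * h * p 0)) * Polynomial.X
        + Polynomial.C (P h * x ^ 3 + P (h * p 2) * x ^ 2 + P (h * p 4) * x))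
      = Polynomial.C (P (d 3) * x ^ 4 + P (d 2) * x ^ 3 + P (d 1) * x ^ 2 + P (d 0) * x)
        + Polynomial.C (P (d 6) * x ^ 2 + P (d 5) * x + P (d 4)) * Polynomial.X := by
    have hPC : 3 * Polynomial.C (Polynomial.C h) = (1 : Polynomial (Polynomial R)) := by
      rw [← Polynomial.C_1, ← hP, Polynomial.C_mul, map_ofNat]
    simp [ψ, comb, colMonomial, derX, derY, Fin.sum_univ_succ] at e
    simp only [ψ, coe_eval₂Hom, P, x, Polynomial.C_add, Polynomial.C_mul, Polynomial.C_pow, map_ofNat]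
    grind
  have ha : (Polynomial.C 3 * x ^ 2 + Polynomial.C (2 * p 2) * x + P (p 4)).natDegree = 2 := by
    simp only [x, P]; compute_degree!
  have hb : (Polynomial.C (4 * p 1) * x ^ 3 + Polynomial.C (3 * p 3) * x ^ 2
          + Polynomial.C (2 * p 5) * x + P (p 6)).natDegree ≤ 3 := by
    simp only [x, P]; compute_degree
  have hcd : (P h * x ^ 3 + P (h * p 2) * x ^ 2 + P (h * p 4) * x).natDegree = 3 := by
    simp only [x, P]; compute_degree!
  have hres : 7 ≤ ((Polynomial.C 3 * x ^ 2 + Polynomial.C (2 * p 2) * x + P (p 4)) ^ 2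
      * (P h * x ^ 3 + P (h * p 2) * x ^ 2 + P (h * p 4) * x)
      + (Polynomial.C (4 * p 1) * x ^ 3 + Polynomial.C (3 * p 3) * x ^ 2
          + Polynomial.C (2 * p 5) * x + P (p 6)) ^ 2
      - Polynomial.C (2 * h * p 0) * (Polynomial.C 3 * x ^ 2 + Polynomial.C (2 * p 2) * x + P (p 4))
        * (Polynomial.C (4 * p 1) * x ^ 3 + Polynomial.C (3 * p 3) * x ^ 2
          + Polynomial.C (2 * p 5) * x + P (p 6))).natDegree := by
    generalize Polynomial.C 3 * x ^ 2 + Polynomial.C (2 * p 2) * x + P (p 4) = a at *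
    generalize P h * x ^ 3 + P (h * p 2) * x ^ 2 + P (h * p 4) * x = g at *
    generalize Polynomial.C (4 * p 1) * x ^ 3 + Polynomial.C (3 * p 3) * x ^ 2
          + Polynomial.C (2 * p 5) * x + P (p 6) = b at *
    have hane : a ≠ 0 := by rintro rfl; simp at ha
    have hgne : g ≠ 0 := by rintro rfl; simp at hcd
    have t1 : (a ^ 2 * g).natDegree = 7 := by
      rw [Polynomial.natDegree_mul (pow_ne_zero 2 hane) hgne, Polynomial.natDegree_pow, ha, hcd]
    have t2 : (b ^ 2 - Polynomial.C (2 * h * p 0) * a * b).natDegree ≤ 6 := by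
      refine (Polynomial.natDegree_sub_le _ _).trans (max_le ?_ ?_)
      · rw [Polynomial.natDegree_pow]; omega
      · refine Polynomial.natDegree_mul_le.trans ?_
        have := Polynomial.natDegree_C_mul_le (2 * h * p 0) a
        omega
    rw [add_sub_assoc, Polynomial.natDegree_add_eq_left_of_natDegree_lt (by omega), t1]
  obtain ⟨z0, z1⟩ := remainder_unique _ _ _ _ _ _ _ _ ha hb (by simp [x, P, h6]) hres
    (by simp only [x, P]; compute_degree) (by simp [x, P]) (by simp only [x, P]; compute_degree) e2
  have c0 := fun n => congrArg (fun q : Polynomial R => q.coeff n) z0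
  have c1 := fun n => congrArg (fun q : Polynomial R => q.coeff n) z1
  simp only [x, P, Polynomial.coeff_add, Polynomial.coeff_C_mul, Polynomial.coeff_X_pow,
    Polynomial.coeff_X, Polynomial.coeff_C, Polynomial.coeff_zero] at c0 c1
  ext j
  fin_cases j
  · simpa using c0 1
  · simpa using c0 2
  · simpa using c0 3
  · simpa using c0 4
  · simpa using c1 0
  · simpa using c1 1
  · simpa using c1 2

theorem IsCoefficientMatrix.unique [IsDomain R] {p : Fin 7 → R} {h : R} (hh : 3 * h = 1)
    (h6 : p 6 ≠ 0) {A B : Matrix (Fin 7) (Fin 7) R}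
    (hA : IsCoefficientMatrix p A) (hB : IsCoefficientMatrix p B) : A = B := by
  ext i j
  have := sub_mem (hB i) (hA i)
  rw [sub_sub_sub_cancel_left, ← Finset.sum_sub_distrib] at this
  have hz := comb_eq_zero p h hh h6 (fun j => A i j - B i j) (by
    simpa only [comb, C_sub, sub_mul] using this)
  exact sub_eq_zero.1 (congrFun hz j)

theorem auxV_map {S : Type*} [CommRing S] (f : R →+* S) (p : Fin 7 → R) (h : R) :
    (fun i => f (auxV p h i)) = auxV (fun i => f (p i)) (f h) := by
  ext i; fin_cases i <;> simp [auxV, map_ofNat]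

set_option maxHeartbeats 1000000 in
theorem auxX_map {S : Type*} [CommRing S] (f : R →+* S) (p : Fin 7 → R) (h : R) :
    (auxX p h).map f = auxX (fun i => f (p i)) (f h) := by
  ext i j
  fin_cases i <;> fin_cases j <;> simp [auxX, map_ofNat]

set_option maxHeartbeats 1000000 in
theorem auxY_map {S : Type*} [CommRing S] (f : R →+* S) (p : Fin 7 → R) (h : R) :
    (auxY p h).map f = auxY (fun i => f (p i)) (f h) := by
  ext i j
  fin_cases i <;> fin_cases j <;> simp [auxY, map_ofNat]

open Matrix in
theorem auxA_map {S : Type*} [CommRing S] (f : R →+* S) (p : Fin 7 → R) (h : R) :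
    (auxA p h).map f = auxA (fun i => f (p i)) (f h) := by
  have hm : ∀ (v : Fin 7 → R) (M : Matrix (Fin 7) (Fin 7) R),
      (fun j => f ((v ᵥ* M) j)) = (fun j => f (v j)) ᵥ* M.map f := by
    intro v M; ext j; exact RingHom.map_vecMul f M v j
  ext i j
  rw [auxA, auxA, ← auxX_map, ← auxY_map, ← auxV_map]
  simp only [← hm]
  fin_cases i <;> rfl


open Matrix in
theorem dvd_det_mul (A : Matrix (Fin 7) (Fin 7) R) (w : Fin 7 → R) (q : R)
    (hq : ∀ i, q ∣ (A *ᵥ w) i) (i : Fin 7) : q ∣ A.det * w i := by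
  have e : A.adjugate *ᵥ (A *ᵥ w) = A.det • w := by
    rw [mulVec_mulVec, adjugate_mul, smul_mulVec, one_mulVec]
  have := congrFun e i
  rw [Pi.smul_apply, smul_eq_mul] at this
  rw [← this]
  change q ∣ ∑ j, A.adjugate i j * (A *ᵥ w) j
  exact Finset.dvd_sum fun j _ => Dvd.dvd.mul_left (hq j) _

theorem third : 3 * C (1 / 3) = (1 : MvPolynomial (Fin 7) ℂ) := by
  rw [← map_ofNat (C : ℂ →+* MvPolynomial (Fin 7) ℂ) 3, ← C_mul]; norm_num

theorem half : 2 * C (1 / 2) = (1 : MvPolynomial (Fin 7) ℂ) := by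
  rw [← map_ofNat (C : ℂ →+* MvPolynomial (Fin 7) ℂ) 2, ← C_mul]; norm_num

theorem existsUnique_coefficientMatrix :
    ∃! A, IsCoefficientMatrix (X : Fin 7 → MvPolynomial (Fin 7) ℂ) A :=
  ⟨_, auxA_isCoefficientMatrix _ _ _ third half, fun _ hA =>
    hA.unique third (X_ne_zero 6) (auxA_isCoefficientMatrix _ _ _ third half)⟩

/-- The `7 × 7` matrix `A` over `ℂ[s₃, t₁, t₂, t₃, t₄, t₅, t₇]` (the variables are `X 0, …, X 6` in
this order): the unique coefficient matrix of the family with independent parameters. -/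
def coefficientMatrix : Matrix (Fin 7) (Fin 7) (MvPolynomial (Fin 7) ℂ) :=
  existsUnique_coefficientMatrix.choose

theorem coefficientMatrix_spec :
    IsCoefficientMatrix (X : Fin 7 → MvPolynomial (Fin 7) ℂ) coefficientMatrix :=
  existsUnique_coefficientMatrix.choose_spec.1

theorem coefficientMatrix_eq : coefficientMatrix = auxA X (C (1 / 3)) :=
  coefficientMatrix_spec.unique third (X_ne_zero 6) (auxA_isCoefficientMatrix _ _ _ third half)

theorem X_dvd_det : (X 6 : MvPolynomial (Fin 7) ℂ) ∣ coefficientMatrix.det := by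
  have h := dvd_det_mul _ _ _
    (auxA_mulVec_one (X : Fin 7 → MvPolynomial (Fin 7) ℂ) (C (1 / 3)) third) 0
  rw [← coefficientMatrix_eq] at h
  refine (X_prime.dvd_or_dvd h).resolve_right fun h' => ?_
  have := map_dvd (eval (Pi.single 0 1 : Fin 7 → ℂ)) h'
  simp at this

theorem exists_deltaTilde :
    ∃ D : MvPolynomial (Fin 7) ℂ, coefficientMatrix.det = C ((7 / 9) ^ 7) * X 6 * D := by
  obtain ⟨D, hD⟩ := X_dvd_det
  refine ⟨C ((9 / 7) ^ 7) * D, ?_⟩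
  have : (C ((7 / 9) ^ 7) * C ((9 / 7) ^ 7) : MvPolynomial (Fin 7) ℂ) = 1 := by
    rw [← C_mul]; norm_num
  rw [hD]
  linear_combination (-X 6 * D) * this

/-- The discriminant of the seven-parameter family: the polynomial in `(s₃, t₁, …, t₅, t₇)` with
`det A = (7/9)⁷ t₇ deltaTilde` (it is unique, since polynomials over `ℂ` form a domain). -/
def deltaTilde : MvPolynomial (Fin 7) ℂ := exists_deltaTilde.choose

theorem det_coefficientMatrix :
    coefficientMatrix.det = C ((7 / 9) ^ 7) * X 6 * deltaTilde :=
  exists_deltaTilde.choose_spec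

/-- The substitution `s₃ = 0`, into `ℂ[t₁, t₂, t₃, t₄, t₅, t₇]` with variables `X 0, …, X 5` in this
order, so that `t₇ = X 5`. -/
def setS3Zero : MvPolynomial (Fin 7) ℂ →ₐ[ℂ] MvPolynomial (Fin 6) ℂ :=
  aeval (Fin.cons 0 X)

theorem exists_deltaST34 :
    ∃ D : MvPolynomial (Fin 6) ℂ, setS3Zero deltaTilde = X 5 * D := by
  have hth : 3 * C (1 / 3) = (1 : MvPolynomial (Fin 6) ℂ) := by
    rw [← map_ofNat (C : ℂ →+* MvPolynomial (Fin 6) ℂ) 3, ← C_mul]; norm_num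
  have hB : (coefficientMatrix.map setS3Zero).det
      = C ((7 / 9) ^ 7) * X 5 * setS3Zero deltaTilde := by
    have h5 : setS3Zero (X 6) = X 5 := by
      simp only [setS3Zero, aeval_X]; rfl
    have := congrArg setS3Zero det_coefficientMatrix
    rw [AlgHom.map_det, map_mul, map_mul, h5, algHom_C] at this
    exact this
  have hA : coefficientMatrix.map setS3Zero = auxA (Fin.cons 0 X) (C (1 / 3)) := by
    rw [coefficientMatrix_eq]
    refine (auxA_map setS3Zero.toRingHom _ _).trans ?_
    congr 1
    · ext1 i; simp [setS3Zero]
    · exact algHom_C _ _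
  have h := dvd_det_mul _ _ _ (auxA_mulVec_two (Fin.cons 0 X : Fin 7 → MvPolynomial (Fin 6) ℂ)
    (C (1 / 3)) hth rfl) 4
  rw [← hA, hB] at h
  change (X 5 : MvPolynomial (Fin 6) ℂ) ^ 2 ∣ _ * (C (1 / 3) * X 3 ^ 2) at h
  have h2 := X_prime.pow_dvd_of_dvd_mul_right 2 (fun h' => by
    have := map_dvd (eval (Pi.single 3 1 : Fin 6 → ℂ)) h'
    simp at this) h
  obtain ⟨E, hE⟩ := h2
  refine ⟨C ((9 / 7) ^ 7) * E, ?_⟩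
  have : (C ((7 / 9) ^ 7) * C ((9 / 7) ^ 7) : MvPolynomial (Fin 6) ℂ) = 1 := by
    rw [← C_mul]; norm_num
  refine mul_left_cancel₀ (X_ne_zero (R := ℂ) (5 : Fin 6)) ?_
  linear_combination C ((9 / 7) ^ 7) * hE - X 5 * setS3Zero deltaTilde * this

/-- The polynomial `deltaST34` in `τ = (t₁, t₂, t₃, t₄, t₅, t₇)` with
`deltaTilde (0, τ) = t₇ deltaST34 (τ)` (again unique). -/
def deltaST34 : MvPolynomial (Fin 6) ℂ := exists_deltaST34.choose

theorem setS3Zero_deltaTilde : setS3Zero deltaTilde = X 5 * deltaST34 :=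
  exists_deltaST34.choose_spec

/-- The polynomial `f_τ` of the six-parameter family, `τ = (t₁, t₂, t₃, t₄, t₅, t₇)`, so that
`t₇ = τ 5`. It is the case `s₃ = 0` of the seven-parameter family. -/
def familyPoly (τ : Fin 6 → ℂ) : MvPolynomial (Fin 3) ℂ := surfacePoly (Fin.cons 0 τ)

/-- The set of all `τ` for which the surface `f_τ = 0` has a singular point. -/
def criticalLocus : Set (Fin 6 → ℂ) :=
  {τ | ∃ v : Fin 3 → ℂ, eval v (familyPoly τ) = 0 ∧ ∀ k, eval v (pderiv k (familyPoly τ)) = 0}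

end

end ST34

/-! Write `J` for the Jacobian ideal. When `t₇ ≠ 0` the monomials `nⱼ` span modulo `J` the ideal
generated by `x` and `y`, and `A` records multiplication by `f` from the `mᵢ` to the `nⱼ`. At `s₃ =
0` its determinant is `(7/9)⁷ t₇² δ`, by `det_auxA_eval`, so both claims about `δ` become claims
about `det A`.

Shape of `δ`: `f` is weighted homogeneous of weight 9 for `x, y` of weight 2, 3 and parameters
weighted by their index. Hence `det A` has weight 56 and `δ` has weight `56 - 2 · 7 = 42`
(`weight_of_mem_support`). Since `t₇` has weight 7, its degree in `δ` is at most 6, and only the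
pure power `t₇⁶` attains this. Its coefficient is found at the point where `t₇ = 1` and the other
parameters vanish, where `A` is `7/9` times the identity (`coeff_single_deltaST34`).

Critical locus: for `t₇ = 0` the origin is singular. For `t₇ ≠ 0`, a singular point makes the values
of the `nⱼ` a kernel vector of `A`, nonzero because the point is not on `x = y = 0`. Conversely,
without singular points `f` is a unit modulo `J` by the Nullstellensatz, so a left kernel vector of
`A` would give a linear relation between the `mᵢ` modulo `J`, which `rowMonomial_independent`
excludes. -/

namespace ST34

open MvPolynomial Matrix

/-! ### Weighted homogeneity of the coefficient matrix -/

section Scaling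

variable {R : Type*} [CommRing R]

/-- The weights of the parameters `s₃, t₁, t₂, t₃, t₄, t₅, t₇`. -/
def parameterWeight : Fin 7 → ℕ := ![3, 1, 2, 3, 4, 5, 7]

/-- The weights of the row monomials `1, x, x², x³, x⁴, y, xy`. -/
def rowWeight : Fin 7 → ℕ := ![0, 2, 4, 6, 8, 3, 5]

/-- The weights of the column monomials `x, x², x³, x⁴, y, xy, x²y`. -/
def colWeight : Fin 7 → ℕ := ![2, 4, 6, 8, 3, 5, 7]

/-- The `j`-th coordinate has weight `9 - colWeight j`. The power of `c` is kept on the left, here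
and below, so that neither subtraction of exponents nor invertibility of `c` is needed. -/
theorem auxV_scale (p : Fin 7 → R) (h c : R) (j : Fin 7) :
    auxV (fun i => c ^ parameterWeight i * p i) h j * c ^ colWeight j = c ^ 9 * auxV p h j := by
  fin_cases j <;> simp [auxV, parameterWeight, colWeight] <;> ring

set_option maxHeartbeats 1000000 in
theorem auxX_scale (p : Fin 7 → R) (h c : R) (i j : Fin 7) :
    auxX (fun i => c ^ parameterWeight i * p i) h i j * c ^ colWeight j
      = c ^ (2 + colWeight i) * auxX p h i j := by
  fin_cases i <;> fin_cases j <;> simp [auxX, parameterWeight, colWeight] <;> ring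

set_option maxHeartbeats 1000000 in
theorem auxY_scale (p : Fin 7 → R) (h c : R) (i j : Fin 7) :
    auxY (fun i => c ^ parameterWeight i * p i) h i j * c ^ colWeight j
      = c ^ (3 + colWeight i) * auxY p h i j := by
  fin_cases i <;> fin_cases j <;> simp [auxY, parameterWeight, colWeight] <;> ring

/-- Weights add under composition. Each use of `auxX` or `auxY` raises the weight 9 of `f` by 2 or
3, which produces the shift `rowWeight i` in row `i`. -/
theorem vecMul_scale {v v' : Fin 7 → R} {M M' : Matrix (Fin 7) (Fin 7) R} {c : R} {a b : ℕ}
    (hv : ∀ j, v' j * c ^ colWeight j = c ^ a * v j)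
    (hM : ∀ i j, M' i j * c ^ colWeight j = c ^ (b + colWeight i) * M i j) (j : Fin 7) :
    (v' ᵥ* M') j * c ^ colWeight j = c ^ (b + a) * (v ᵥ* M) j := by
  simp only [vecMul, dotProduct, Finset.sum_mul, Finset.mul_sum]
  refine Finset.sum_congr rfl fun i _ => ?_
  calc v' i * M' i j * c ^ colWeight j = v' i * (M' i j * c ^ colWeight j) := by ring
    _ = c ^ b * (v' i * c ^ colWeight i) * M i j := by rw [hM]; ring
    _ = _ := by rw [hv]; ring

theorem auxA_scale (p : Fin 7 → R) (h c : R) (i j : Fin 7) :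
    auxA (fun i => c ^ parameterWeight i * p i) h i j * c ^ colWeight j
      = c ^ (rowWeight i + 9) * auxA p h i j := by
  have hX := auxX_scale p h c
  have h0 := auxV_scale p h c
  have h1 := vecMul_scale h0 hX
  have h2 := vecMul_scale h1 hX
  have h3 := vecMul_scale h2 hX
  have h4 := vecMul_scale h3 hX
  have h5 := vecMul_scale h0 (auxY_scale p h c)
  have h6 := vecMul_scale h5 hX
  fin_cases i
  · exact h0 j
  · exact h1 j
  · exact h2 j
  · exact h3 j
  · exact h4 j
  · exact h5 j
  · exact h6 j

/-- Rescaling the parameters multiplies `A` by diagonal matrices on both sides. Their determinants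
have exponents `∑ colWeight = 35` and `∑ (rowWeight + 9) = 91`. -/
theorem det_auxA_scale (p : Fin 7 → R) (h c : R) :
    c ^ 35 * (auxA (fun i => c ^ parameterWeight i * p i) h).det = c ^ 91 * (auxA p h).det := by
  have e : auxA (fun i => c ^ parameterWeight i * p i) h * diagonal (fun j => c ^ colWeight j)
      = diagonal (fun i => c ^ (rowWeight i + 9)) * auxA p h := by
    ext i j
    rw [mul_diagonal, diagonal_mul, auxA_scale]
  have := congrArg det e
  rw [det_mul, det_mul, det_diagonal, det_diagonal, Finset.prod_pow_eq_pow_sum,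
    Finset.prod_pow_eq_pow_sum] at this
  have s1 : ∑ j, colWeight j = 35 := by decide
  have s2 : ∑ i, (rowWeight i + 9) = 91 := by decide
  rw [s1, s2] at this
  rw [← this, mul_comm]

end Scaling

/-! ### The determinant at `s₃ = 0` and the weight of `deltaST34` -/

theorem map_setS3Zero_coefficientMatrix :
    coefficientMatrix.map setS3Zero = auxA (Fin.cons 0 X) (C (1 / 3)) := by
  rw [coefficientMatrix_eq]
  refine (auxA_map setS3Zero.toRingHom _ _).trans ?_
  congr 1
  · ext1 i; simp [setS3Zero]
  · exact algHom_C _ _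

theorem det_auxA_cons_zero :
    (auxA (Fin.cons 0 X : Fin 7 → MvPolynomial (Fin 6) ℂ) (C (1 / 3))).det
      = C ((7 / 9) ^ 7) * X 5 ^ 2 * deltaST34 := by
  have h5 : setS3Zero (X 6) = X 5 := by
    simp only [setS3Zero, aeval_X]; rfl
  have := congrArg setS3Zero det_coefficientMatrix
  rw [AlgHom.map_det, map_mul, map_mul, h5, algHom_C, setS3Zero_deltaTilde] at this
  rw [← map_setS3Zero_coefficientMatrix]
  refine Eq.trans this ?_
  rw [MvPolynomial.algebraMap_eq]
  ring

theorem det_auxA_eval (τ : Fin 6 → ℂ) :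
    (auxA (Fin.cons 0 τ : Fin 7 → ℂ) (1 / 3)).det
      = (7 / 9) ^ 7 * τ 5 ^ 2 * eval τ deltaST34 := by
  have := congrArg (eval τ) det_auxA_cons_zero
  rw [RingHom.map_det, map_mul, map_mul, map_pow (eval τ), eval_X, eval_C] at this
  rw [← this]
  congr 1
  refine Eq.trans ?_ (auxA_map (eval τ) _ _).symm
  rw [eval_C]
  congr 1
  ext i
  refine Fin.cases ?_ (fun i => ?_) i <;> simp

/-- Rescaling the variables multiplies each coefficient by a power product. -/
theorem coeff_aeval_C_mul_X {σ K : Type*} [CommSemiring K] (c : σ → K)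
    (q : MvPolynomial σ K) (m : σ →₀ ℕ) :
    coeff m (aeval (fun i => C (c i) * X i) q) = (m.prod fun i k => c i ^ k) * coeff m q := by
  classical
  induction q using MvPolynomial.induction_on' with
  | monomial u a =>
    have : aeval (fun i => C (c i) * X i) (monomial u a)
        = C (u.prod fun i k => c i ^ k) * monomial u a := by
      rw [aeval_monomial, monomial_eq, MvPolynomial.algebraMap_eq]
      simp only [mul_pow, Finsupp.prod, map_prod, map_pow, Finset.prod_mul_distrib]
      ring
    rw [this, coeff_C_mul, coeff_monomial]
    split_ifs with h
    · rw [h]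
    · simp
  | add p q hp hq => rw [map_add, coeff_add, hp, hq, coeff_add, mul_add]

/-- One scaling factor suffices to read off weights, provided its powers are distinct; 2 is such a
factor. -/
theorem deltaST34_scale :
    aeval (fun i : Fin 6 => C ((2 : ℂ) ^ parameterWeight i.succ) * X i) deltaST34
      = C ((2 : ℂ) ^ 42) * deltaST34 := by
  set σ : MvPolynomial (Fin 6) ℂ →ₐ[ℂ] MvPolynomial (Fin 6) ℂ :=
    aeval (fun i : Fin 6 => C ((2 : ℂ) ^ parameterWeight i.succ) * X i) with hσ
  have e := congrArg σ det_auxA_cons_zero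
  have h5 : σ (X 5) = C (2 ^ 7) * X 5 := by rw [hσ, aeval_X]; rfl
  have hA : (auxA (Fin.cons 0 X : Fin 7 → MvPolynomial (Fin 6) ℂ) (C (1 / 3))).map σ
      = auxA (fun i => C 2 ^ parameterWeight i *
        (Fin.cons 0 X : Fin 7 → MvPolynomial (Fin 6) ℂ) i) (C (1 / 3)) := by
    refine (auxA_map σ.toRingHom _ _).trans ?_
    congr 1
    · ext1 i
      refine Fin.cases ?_ (fun i => ?_) i
      · simp
      · simp [hσ]
    · exact algHom_C _ _
  rw [AlgHom.map_det, map_mul, map_mul, map_pow σ, h5, algHom_C, MvPolynomial.algebraMap_eq] at e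
  have hs := det_auxA_scale (Fin.cons 0 X : Fin 7 → MvPolynomial (Fin 6) ℂ) (C (1 / 3)) (C 2)
  rw [← hA, det_auxA_cons_zero] at hs
  rw [show σ.mapMatrix (auxA (Fin.cons 0 X) (C (1 / 3)))
    = (auxA (Fin.cons 0 X : Fin 7 → MvPolynomial (Fin 6) ℂ) (C (1 / 3))).map σ from rfl] at e
  rw [e] at hs
  -- Here `49 = 35 + 14`: the 14 comes from rescaling `t₇²`. What remains of `2 ^ 91` is `2 ^ 42`.
  have hne : C (2 ^ 49 * (7 / 9) ^ 7) * X 5 ^ 2 ≠ (0 : MvPolynomial (Fin 6) ℂ) :=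
    mul_ne_zero (by rw [Ne, C_eq_zero]; norm_num) (pow_ne_zero _ (X_ne_zero _))
  refine mul_left_cancel₀ hne ?_
  simp only [C_mul, C_pow] at hs ⊢
  linear_combination hs

/-- Every monomial of `deltaST34` has weight `42`. -/
theorem weight_of_mem_support {m : Fin 6 →₀ ℕ} (hm : m ∈ deltaST34.support) :
    m 0 + 2 * m 1 + 3 * m 2 + 4 * m 3 + 5 * m 4 + 7 * m 5 = 42 := by
  have e := congrArg (coeff m) deltaST34_scale
  rw [coeff_aeval_C_mul_X, coeff_C_mul] at e
  have e2 := mul_right_cancel₀ (mem_support_iff.1 hm) e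
  rw [Finsupp.prod_fintype _ _ (fun i => pow_zero _), Fin.prod_univ_six] at e2
  simp only [← pow_mul, ← pow_add] at e2
  have e3 := Nat.pow_right_injective le_rfl (a₁ := _) (a₂ := 42) (by exact_mod_cast e2)
  simp [parameterWeight] at e3
  omega

/-! ### The expansion in powers of `t₇` -/

theorem eq_single_of_mem_support {m : Fin 6 →₀ ℕ} (hm : m ∈ deltaST34.support) (h : 6 ≤ m 5) :
    m = Finsupp.single 5 6 := by
  have := weight_of_mem_support hm
  ext i
  fin_cases i <;> simp <;> omega

/-- At the point with `t₇ = 1` and all other parameters zero, every monomial of `deltaST34` other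
than `t₇⁶` vanishes, so the coefficient is the value there. -/
theorem coeff_single_deltaST34 : coeff (Finsupp.single 5 6) deltaST34 = 1 := by
  have h1 : eval (Pi.single 5 1 : Fin 6 → ℂ) deltaST34 = 1 := by
    have hd := det_auxA_eval (Pi.single 5 1)
    have hp : (Fin.cons 0 (Pi.single 5 1 : Fin 6 → ℂ) : Fin 7 → ℂ) = ![0, 0, 0, 0, 0, 0, 1] := by
      ext i; fin_cases i <;> rfl
    have hX : auxX ![0, 0, 0, 0, 0, 0, (1 : ℂ)] (1 / 3) =
        !![0, 1, 0, 0, 0, 0, 0; 0, 0, 1, 0, 0, 0, 0; 0, 0, 0, 1, 0, 0, 0; 0, 0, 0, 0, 1, 0, 0;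
          0, 0, 0, 0, 0, 1, 0; 0, 0, 0, 0, 0, 0, 1; -1 / 3, 0, 0, 0, 0, 0, 0] := by
      ext i j; fin_cases i <;> fin_cases j <;> simp [auxX]; norm_num
    -- Euler's relation: modulo `J`, `9 f ≡ 7 t₇ x` at this point.
    have hV : auxV ![0, 0, 0, 0, 0, 0, (1 : ℂ)] (1 / 3) = ![7 / 9, 0, 0, 0, 0, 0, 0] := by
      ext i; fin_cases i <;> simp [auxV]; norm_num
    have hY : (![7 / 9, 0, 0, 0, 0, 0, 0] : Fin 7 → ℂ) ᵥ* auxY ![0, 0, 0, 0, 0, 0, (1 : ℂ)] (1 / 3)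
        = ![0, 0, 0, 0, 0, 7 / 9, 0] := by
      ext i; fin_cases i <;> simp [vecMul, auxY, dotProduct, Fin.sum_univ_succ]
    -- Since `f ≡ (7/9) x` and `mᵢ x = nᵢ` for every `i`, the matrix is scalar.
    have hA : auxA ![0, 0, 0, 0, 0, 0, (1 : ℂ)] (1 / 3) = diagonal fun _ => 7 / 9 := by
      have x0 : ∀ a b c d f g : ℂ, ![a, b, c, d, f, g, 0] ᵥ*
          auxX ![0, 0, 0, 0, 0, 0, (1 : ℂ)] (1 / 3) = ![0, a, b, c, d, f, g] := by
        intro a b c d f g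
        rw [hX]
        ext i; fin_cases i <;> simp [vecMul, dotProduct, Fin.sum_univ_succ]
      simp only [auxA, hV, hY, x0]
      ext i j; fin_cases i <;> fin_cases j <;> rfl
    rw [hp, hA, det_diagonal] at hd
    simp only [Finset.prod_const, Finset.card_univ, Fintype.card_fin, Pi.single_eq_same, one_pow,
      mul_one] at hd
    exact mul_left_cancel₀ (by norm_num : ((7 : ℂ) / 9) ^ 7 ≠ 0) (by rw [← hd, mul_one])
  rw [eval_eq'] at h1
  rw [← h1]
  rw [Finset.sum_eq_single (Finsupp.single 5 6)]
  · rw [Finset.prod_eq_one, mul_one]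
    intro i _
    fin_cases i <;> simp
  · intro m hm hne
    have hw := weight_of_mem_support hm
    by_contra hz
    have hi : ∀ i : Fin 6, i ≠ 5 → m i = 0 := by
      intro i hi
      by_contra h0
      refine hz (mul_eq_zero_of_right _ (Finset.prod_eq_zero (Finset.mem_univ i) ?_))
      rw [Pi.single_eq_of_ne hi, zero_pow h0]
    have h0 := hi 0 (by decide)
    have h1 := hi 1 (by decide)
    have h2 := hi 2 (by decide)
    have h3 := hi 3 (by decide)
    have h4 := hi 4 (by decide)
    exact hne (eq_single_of_mem_support hm (by omega))
  · intro h
    rw [notMem_support_iff.1 h, zero_mul]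

/-- The coefficient of `tₙᵏ` in a polynomial in `t₀, …, tₙ`, as a polynomial in the other
variables. -/
noncomputable def lastCoeff {n : ℕ} {K : Type*} [CommSemiring K]
    (q : MvPolynomial (Fin (n + 1)) K) (k : ℕ) : MvPolynomial (Fin n) K :=
  ∑ m ∈ q.support with m (Fin.last n) = k,
    monomial (m.comapDomain Fin.castSucc (Fin.castSucc_injective n).injOn) (coeff m q)

/-- Monomials are grouped by their exponent in the last variable. The sum runs down from degree `d`,
so that `j = 0` is the leading term. -/
theorem sum_lastCoeff {n : ℕ} {K : Type*} [CommSemiring K] (q : MvPolynomial (Fin (n + 1)) K)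
    {d : ℕ} (hd : ∀ m ∈ q.support, m (Fin.last n) ≤ d) :
    q = ∑ j ∈ Finset.range (d + 1),
      rename Fin.castSucc (lastCoeff q (d - j)) * X (Fin.last n) ^ (d - j) := by
  rw [Finset.sum_range_reflect (fun k => rename Fin.castSucc (lastCoeff q k) * X (Fin.last n) ^ k)
    (d + 1) |>.symm.trans (Finset.sum_congr rfl fun j _ => by rw [Nat.add_sub_cancel])
    |>.symm]
  conv_lhs => rw [q.as_sum]
  rw [← Finset.sum_fiberwise_of_maps_to (s := q.support) (t := Finset.range (d + 1))
    (g := fun m => m (Fin.last n)) (fun m hm => Finset.mem_range.2 (Nat.lt_succ_of_le (hd m hm)))]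
  refine Finset.sum_congr rfl fun k _ => ?_
  rw [lastCoeff, map_sum, Finset.sum_mul]
  refine Finset.sum_congr rfl fun m hm => ?_
  rw [rename_monomial, X_pow_eq_monomial, monomial_mul, mul_one]
  refine congrArg (fun s => monomial s (coeff m q)) (Finsupp.ext fun i => ?_)
  rw [Finsupp.add_apply]
  refine Fin.lastCases ?_ (fun i => ?_) i
  · rw [Finsupp.mapDomain_of_notMem_range _ _ (by
      rintro ⟨x, hx⟩; exact (Fin.castSucc_lt_last x).ne hx), Finsupp.single_eq_same, zero_add]
    exact (Finset.mem_filter.1 hm).2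
  · rw [Finsupp.mapDomain_apply (Fin.castSucc_injective n), Finsupp.comapDomain_apply,
      Finsupp.single_eq_of_ne (Fin.castSucc_lt_last i).ne, add_zero]

theorem lastCoeff_deltaST34 : lastCoeff deltaST34 6 = 1 := by
  have hs : deltaST34.support.filter (fun m => m (Fin.last 5) = 6) = {Finsupp.single 5 6} := by
    ext m
    rw [Finset.mem_filter, Finset.mem_singleton]
    constructor
    · rintro ⟨hm, h6⟩
      exact eq_single_of_mem_support hm h6.ge
    · rintro rfl
      refine ⟨?_, Finsupp.single_eq_same⟩
      rw [mem_support_iff, coeff_single_deltaST34]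
      exact one_ne_zero
  rw [lastCoeff, hs, Finset.sum_singleton, coeff_single_deltaST34]
  rw [show (Finsupp.single (5 : Fin 6) 6).comapDomain Fin.castSucc
    (Fin.castSucc_injective 5).injOn = 0 from ?_]
  · rfl
  · ext i
    exact Finsupp.single_eq_of_ne (Fin.castSucc_lt_last i).ne

theorem exists_deltaST34_eq : ∃ A : ℕ → MvPolynomial (Fin 5) ℂ,
    deltaST34 = X 5 ^ 6 + ∑ j ∈ Finset.Icc 1 6, rename Fin.castSucc (A j) * X 5 ^ (6 - j) := by
  refine ⟨fun j => lastCoeff deltaST34 (6 - j), ?_⟩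
  have h := sum_lastCoeff deltaST34 (d := 6) fun m hm => by
    have := weight_of_mem_support hm
    change m 5 ≤ 6
    omega
  -- The term `j = 0` splits off as `t₇⁶`; shifting the other indices by one turns their range into
  -- `Icc 1 6`.
  rw [Finset.sum_range_succ', Nat.sub_zero, lastCoeff_deltaST34, map_one, one_mul] at h
  rw [Finset.range_eq_Ico, Finset.sum_Ico_add'
    (fun j => rename Fin.castSucc (lastCoeff deltaST34 (6 - j)) * X (Fin.last 5) ^ (6 - j))] at h
  exact h.trans (add_comm _ _)

/-! ### The critical locus as the zero set of the determinant -/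

section CriticalLocus

variable (τ : Fin 6 → ℂ)

theorem isCoefficientMatrix_eval :
    IsCoefficientMatrix (Fin.cons 0 τ : Fin 7 → ℂ) (auxA (Fin.cons 0 τ) (1 / 3)) :=
  auxA_isCoefficientMatrix _ _ (1 / 2) (by norm_num) (by norm_num)

theorem eval_eq_zero_of_mem_jacobianIdeal {p : Fin 7 → ℂ} {v : Fin 3 → ℂ}
    (hv : ∀ k, eval v (pderiv k (surfacePoly p)) = 0) {q : MvPolynomial (Fin 3) ℂ}
    (hq : q ∈ jacobianIdeal p) : eval v q = 0 := by
  have : jacobianIdeal p ≤ RingHom.ker (eval v) := by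
    refine Ideal.span_le.2 ?_
    rintro _ ⟨k, rfl⟩
    exact hv k
  exact this hq

/-- If `p₆ ≠ 0` and `s₃ = 0`, the row monomials are linearly independent modulo the Jacobian
ideal. -/
theorem rowMonomial_independent {p : Fin 7 → ℂ} (h0 : p 0 = 0) (h6 : p 6 ≠ 0) (a : Fin 7 → ℂ)
    (ha : ∑ i, C (a i) * rowMonomial ℂ i ∈ jacobianIdeal p) : a = 0 := by
  have hh : 3 * (1 / 3 : ℂ) = 1 := by norm_num
  set b := auxX p (1 / 3) 3 with hb
  -- Multiplication by `x` sends the `mᵢ` to the `nⱼ` other than `y`, except that `x⁴` goes to `x⁵`.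
  -- The reduction `b` of `x⁵` has `y`-coordinate `t₇`, so comparing coordinates of `y` forces `a 4
  -- = 0`, and then the others vanish.
  have hb4 : b 4 = p 6 := by simp [hb, auxX, h0]
  have key : comb ![a 0 + a 4 * b 0, a 1 + a 4 * b 1, a 2 + a 4 * b 2, a 3 + a 4 * b 3,
      a 4 * b 4, a 5 + a 4 * b 5, a 6 + a 4 * b 6] ∈ jacobianIdeal p := by
    have h1 := Ideal.mul_mem_left _ (X 0) ha
    have h2 := Ideal.mul_mem_left _ (C (a 4)) (auxX_mem p (1 / 3) hh 3)
    rw [← hb] at h2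
    convert sub_mem h1 h2 using 1
    simp [comb, colMonomial, rowMonomial, Fin.sum_univ_succ]
    ring
  have hz := comb_eq_zero p (1 / 3) hh h6 _ key
  have z := fun i => congrFun hz i
  have a4 : a 4 = 0 := by
    have := z 4
    simp [hb4, h6] at this
    exact this
  ext i
  fin_cases i
  · simpa [a4] using z 0
  · simpa [a4] using z 1
  · simpa [a4] using z 2
  · simpa [a4] using z 3
  · exact a4
  · simpa [a4] using z 5
  · simpa [a4] using z 6

/-- Without singular points the polynomial is invertible modulo its Jacobian ideal. -/
theorem exists_inverse_mod_jacobianIdeal {p : Fin 7 → ℂ}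
    (h : ∀ v, eval v (surfacePoly p) = 0 → ¬ ∀ k, eval v (pderiv k (surfacePoly p)) = 0) :
    ∃ u, u * surfacePoly p - 1 ∈ jacobianIdeal p := by
  set I := Ideal.span {surfacePoly p} ⊔ jacobianIdeal p with hI
  -- A common zero of `f` and `J` would be a singular point, so the Nullstellensatz puts 1 into the
  -- radical of `I`, hence into `I`.
  have hz : zeroLocus ℂ I = ∅ := by
    refine Set.eq_empty_of_forall_notMem fun v hv => ?_
    refine h v ?_ fun k => ?_
    · exact hv _ (Ideal.mem_sup_left (Ideal.mem_span_singleton_self _))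
    · exact hv _ (Ideal.mem_sup_right (Ideal.subset_span ⟨k, rfl⟩))
  have hr := vanishingIdeal_zeroLocus_eq_radical (k := ℂ) (K := ℂ) I
  have h1 : (1 : MvPolynomial (Fin 3) ℂ) ∈ I.radical := by
    rw [← hr, mem_vanishingIdeal_iff, hz]
    rintro x ⟨⟩
  obtain ⟨n, hn⟩ := h1
  rw [one_pow] at hn
  obtain ⟨a, ha, b, hb, hab⟩ := Submodule.mem_sup.1 hn
  obtain ⟨u, rfl⟩ := Ideal.mem_span_singleton'.1 ha
  refine ⟨u, ?_⟩
  rw [← hab, sub_add_cancel_left]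
  exact neg_mem hb

theorem mem_criticalLocus_of_zero (h : τ 5 = 0) : τ ∈ criticalLocus := by
  have h6 : (Fin.cons 0 τ : Fin 7 → ℂ) 6 = 0 := h
  -- The origin is singular, because `t₇ x` is the only term of `f` of degree below 2.
  refine ⟨0, ?_, fun k => ?_⟩
  · simp [familyPoly, surfacePoly]
  · fin_cases k <;> simp [familyPoly, surfacePoly, pderiv_X, h6]

variable {τ}

/-- At a singular point `f` and all of `J` vanish, so the congruences defining `A` say that `A`
kills the vector of values of the `nⱼ`. -/
theorem det_eq_zero_of_mem_criticalLocus (h : τ 5 ≠ 0) (hτ : τ ∈ criticalLocus) :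
    (auxA (Fin.cons 0 τ : Fin 7 → ℂ) (1 / 3)).det = 0 := by
  obtain ⟨v, hv, hd⟩ := hτ
  by_contra hne
  have hn : auxA (Fin.cons 0 τ) (1 / 3) *ᵥ (fun j => eval v (colMonomial ℂ j)) = 0 := by
    ext i
    have := eval_eq_zero_of_mem_jacobianIdeal hd (isCoefficientMatrix_eval τ i)
    rw [map_sub, map_mul, show eval v (surfacePoly (Fin.cons 0 τ)) = 0 from hv, mul_zero, zero_sub,
      neg_eq_zero, map_sum] at this
    simpa [mulVec, dotProduct] using this
  have hn0 := eq_zero_of_mulVec_eq_zero hne hn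
  have hx : v 0 = 0 := by simpa [colMonomial] using congrFun hn0 0
  have hy : v 1 = 0 := by simpa [colMonomial] using congrFun hn0 4
  -- On `x = y = 0` the derivative `∂f/∂x` equals `t₇`, which is nonzero.
  have h0 := hd 0
  rw [familyPoly, pderiv_zero_surfacePoly] at h0
  simp [derX, hx, hy] at h0
  exact h h0

/-- A left kernel vector `a` gives `(∑ aᵢ mᵢ) f ∈ J`. If there were no singular point, `f` could be
cancelled modulo `J`, contradicting the independence of the `mᵢ`. -/
theorem mem_criticalLocus_of_det_eq_zero (h : τ 5 ≠ 0)
    (hdet : (auxA (Fin.cons 0 τ : Fin 7 → ℂ) (1 / 3)).det = 0) : τ ∈ criticalLocus := by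
  obtain ⟨a, ha, hA⟩ := exists_vecMul_eq_zero_iff.2 hdet
  by_contra hτ
  obtain ⟨u, hu⟩ := exists_inverse_mod_jacobianIdeal (p := Fin.cons 0 τ)
    fun v hv hd => hτ ⟨v, hv, hd⟩
  refine ha (rowMonomial_independent (p := Fin.cons 0 τ) rfl h a ?_)
  set p : Fin 7 → ℂ := Fin.cons 0 τ
  have h1 : (∑ i, C (a i) * rowMonomial ℂ i) * surfacePoly p ∈ jacobianIdeal p := by
    have hs := Ideal.sum_mem (jacobianIdeal p) (t := Finset.univ) fun i _ =>
      Ideal.mul_mem_left _ (C (a i)) (isCoefficientMatrix_eval τ i)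
    have hc : ∑ i, C (a i) * comb (auxA p (1 / 3) i) = 0 := by
      rw [← comb_vecMul, hA]
      simp [comb]
    have e : (∑ i, C (a i) * rowMonomial ℂ i) * surfacePoly p
        = ∑ i, C (a i) * (rowMonomial ℂ i * surfacePoly p - comb (auxA p (1 / 3) i)) := by
      simp only [mul_sub, Finset.sum_sub_distrib, hc, sub_zero, Finset.sum_mul, mul_assoc]
    rw [e]
    exact hs
  -- With `g = ∑ aᵢ mᵢ` and `u f ≡ 1`, the identity is `g = u (g f) - g (u f - 1)`.
  have h2 := sub_mem (Ideal.mul_mem_left _ u h1)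
    (Ideal.mul_mem_left _ (∑ i, C (a i) * rowMonomial ℂ i) hu)
  convert h2 using 1
  ring

end CriticalLocus

end ST34

theorem mainTheorem4 :
    (∃ A : ℕ → MvPolynomial (Fin 5) ℂ,
      ST34.deltaST34 = MvPolynomial.X 5 ^ 6 + ∑ j ∈ Finset.Icc 1 6,
        MvPolynomial.rename Fin.castSucc (A j) * MvPolynomial.X 5 ^ (6 - j)) ∧
    ST34.criticalLocus =
      {τ : Fin 6 → ℂ | τ 5 * MvPolynomial.eval τ ST34.deltaST34 = 0} := by
  refine ⟨ST34.exists_deltaST34_eq, Set.ext fun τ => ?_⟩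
  rw [Set.mem_ofPred_eq]
  by_cases h : τ 5 = 0
  · rw [h, zero_mul]
    exact iff_of_true (ST34.mem_criticalLocus_of_zero τ h) rfl
  have hd := ST34.det_auxA_eval τ
  constructor
  · intro hτ
    rw [ST34.det_eq_zero_of_mem_criticalLocus h hτ] at hd
    have hz := (mul_eq_zero.1 hd.symm).resolve_left
      (mul_ne_zero (by norm_num) (pow_ne_zero 2 h))
    rw [hz, mul_zero]
  · intro hτ
    rw [(mul_eq_zero.1 hτ).resolve_left h, mul_zero] at hd
    exact ST34.mem_criticalLocus_of_det_eq_zero h hd
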